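/- Let $K$ be a metric space. A finite Markov system $\mathcal M=(K_{i(e)},w_e,p_e)_{e\in E}$ on $K$ consists of a partition of $K$ into finitely many non-empty Borel sets $K_i$ ($i\in V$), a finite directed multigraph with vertex set $V$, edge set $E$ and initial and terminal vertex maps $i,t:E\to V$, Borel maps $w_e:K_{i(e)}\to K_{t(e)}$ and positive Borel functions $p_e$ on $K_{i(e)}$, extended by $0$ to $K$, such that $\sum_{e\in E}p_e(x)=1$ for all $x\in K$. Assume that, for every $e\in E$, the set $K_{i(e)}$ is open in $K$, $w_e|_{K_{i(e)}}$ is continuous, and $p_e|_{K_{i(e)}}$ is continuous and bounded away from zero. For bounded continuous $f:K\to\mathbb R$ let $Uf=\sum_{e\in E}p_e\cdot f\circ w_e$; a Borel probability measure $\nu$ on $K$ is invariant for $\mathcal M$ if $\int Uf\,d\nu=\int f\,d\nu$ for all such $f$. The system $\mathcal M$ is contractive if there is $0<a<1$ such that $\sum_{e\in E}p_e(x)\,d(w_e(x),w_e(y))\le a\,d(x,y)$ whenever $x,y\in K_{i(e')}$ for some $e'\in E$. For $x\in K$ let $P_x$ be the Borel probability measure on $\Sigma^+=\{(\sigma_1,\sigma_2,\dots):\sigma_k\in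 E\}$ that gives each cylinder set $_1[e_1,\dots,e_n]=\{\sigma\in\Sigma^+:\sigma_1=e_1,\dots,\sigma_n=e_n\}$ the measure \[P_x({}_1[e_1,\dots,e_n])=p_{e_1}(x)\,p_{e_2}(w_{e_1}(x))\cdots p_{e_n}(w_{e_{n-1}}\circ\dots\circ w_{e_1}(x)).\] Suppose that $\mu$ is the unique invariant Borel probability measure of $\mathcal M$, and that either $K$ is compact, or $K$ is complete and separable and $\mathcal M$ is contractive. Then for every $x\in K$, \[\lim_{n\to\infty}\frac1n\log P_x({}_1[\sigma_1,\dots,\sigma_n])=\sum_{e\in E}\int_{K_{i(e)}}p_e\log p_e\,d\mu\qquad\text{for }P_x\text{-a.e. }\sigma\in\Sigma^+.\] -/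

import Mathlib

open MeasureTheory ProbabilityTheory Filter Topology

/-- A finite Markov system `(K_{i(e)}, w_e, p_e)_{e ∈ E}` on `K`.  The sets `part i`, indexed by the
finite vertex set `V`, form a partition of `K` into non-empty Borel sets; every edge `e` of the finite
directed (multi)graph goes from `init e` to `term e` and carries a Borel map
`w e : part (init e) → part (term e)` and a positive Borel probability function
`p e` on `part (init e)`.  As usual `p e` is extended by zero to all of `K`, and the values of
`w e` outside `part (init e)` are arbitrary (and never matter). -/
structure MarkovSystem (K V E : Type*) [MeasurableSpace K] [Fintype V] [Fintype E] where
  /-- the vertex sets `K_i` -/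
  part : V → Set K
  part_nonempty : ∀ i, (part i).Nonempty
  measurableSet_part : ∀ i, MeasurableSet (part i)
  pairwise_disjoint_part : Pairwise fun i j => Disjoint (part i) (part j)
  iUnion_part : ⋃ i, part i = Set.univ
  /-- the initial vertex `i(e)` of an edge -/
  init : E → V
  /-- the terminal vertex `t(e)` of an edge -/
  term : E → V
  /-- the maps `w_e` -/
  w : E → K → K
  mapsTo_w : ∀ e, Set.MapsTo (w e) (part (init e)) (part (term e))
  measurable_w : ∀ e, Measurable ((part (init e)).domRestrict (w e))
  /-- the probability functions `p_e`, extended by zero -/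
  p : E → K → ℝ
  p_pos : ∀ e, ∀ x ∈ part (init e), 0 < p e x
  p_eq_zero : ∀ e, ∀ x ∉ part (init e), p e x = 0
  sum_p : ∀ x, ∑ e, p e x = 1
  measurable_p : ∀ e, Measurable (p e)

namespace MarkovSystem

section Operator

variable {K V E : Type*} [MeasurableSpace K] [Fintype V] [Fintype E]

/-- The Markov operator `U f = ∑ₑ pₑ · (f ∘ wₑ)`. -/
def U (M : MarkovSystem K V E) (f : K → ℝ) (x : K) : ℝ :=
  ∑ e, M.p e x * f (M.w e x)

/-- `U* ν = ν`, that is `∫ U f dν = ∫ f dν` for all bounded continuous `f`. -/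
def IsInvariant [TopologicalSpace K] (M : MarkovSystem K V E) (ν : Measure K) : Prop :=
  ∀ f : BoundedContinuousFunction K ℝ, ∫ x, M.U f x ∂ν = ∫ x, f x ∂ν

/-- Contractivity (on average) of a Markov system. -/
def IsContractive [MetricSpace K] (M : MarkovSystem K V E) : Prop :=
  ∃ a : ℝ, 0 < a ∧ a < 1 ∧ ∀ e₀ : E, ∀ x ∈ M.part (M.init e₀), ∀ y ∈ M.part (M.init e₀),
    ∑ e, M.p e x * dist (M.w e x) (M.w e y) ≤ a * dist x y

/-- The point `w_{σ_n} ∘ ⋯ ∘ w_{σ_1} (x)`; the sequence `(σ_1, σ_2, …)` is written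
`(σ 0, σ 1, …)`. -/
def orbit (M : MarkovSystem K V E) (x : K) (σ : ℕ → E) : ℕ → K
  | 0 => x
  | n + 1 => M.w (σ n) (M.orbit x σ n)

end Operator

theorem p_nonneg {K V E : Type*} [MeasurableSpace K] [Fintype V] [Fintype E]
    (M : MarkovSystem K V E) (e : E) (y : K) : 0 ≤ M.p e y := by
  by_cases h : y ∈ M.part (M.init e)
  · exact (M.p_pos e y h).le
  · exact (M.p_eq_zero e y h).ge

theorem orbit_congr {K V E : Type*} [MeasurableSpace K] [Fintype V] [Fintype E]
    (M : MarkovSystem K V E) (x : K) {σ τ : ℕ → E} {n : ℕ} (h : ∀ k < n, σ k = τ k) :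
    M.orbit x σ n = M.orbit x τ n := by
  induction n with
  | zero => rfl
  | succ n ih =>
    simp only [orbit]
    rw [ih fun k hk => h k (by omega), h n (by omega)]

end MarkovSystem

/-- The cylinder set `₁[σ_1, …, σ_n]`. -/
def cylinderSet {E : Type*} (σ : ℕ → E) (n : ℕ) : Set (ℕ → E) :=
  {τ | ∀ k < n, τ k = σ k}

namespace MarkovSystem

section PathMeasure

variable {K V E : Type*} [MeasurableSpace K] [Fintype V] [Fintype E] [MeasurableSpace E]
  [DiscreteMeasurableSpace E]

/-- The law of the edge chosen at the point `y`: `e` has probability `p e y`. -/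
noncomputable def edgeLaw (M : MarkovSystem K V E) (y : K) : Measure E :=
  ∑ e, ENNReal.ofReal (M.p e y) • Measure.dirac e

theorem edgeLaw_singleton (M : MarkovSystem K V E) (y : K) (e : E) :
    M.edgeLaw y {e} = ENNReal.ofReal (M.p e y) := by
  classical
  simp only [edgeLaw, Measure.coe_finsetSum, Finset.sum_apply, Measure.smul_apply, smul_eq_mul,
    Measure.dirac_apply, Set.indicator_apply, Set.mem_singleton_iff]
  simp

instance (M : MarkovSystem K V E) (y : K) : IsProbabilityMeasure (M.edgeLaw y) := by
  constructor
  simp only [edgeLaw, Measure.coe_finsetSum, Finset.sum_apply, Measure.smul_apply, smul_eq_mul,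
    measure_univ, mul_one]
  rw [← ENNReal.ofReal_sum_of_nonneg fun e _ => M.p_nonneg e y, M.sum_p, ENNReal.ofReal_one]

/-- A finite word, prolonged to a sequence by repeating its last letter. -/
def prolong {n : ℕ} (h : Finset.Iic n → E) (k : ℕ) : E :=
  h ⟨min k n, Finset.mem_Iic.2 (min_le_right k n)⟩

/-- The conditional law of the next edge, given the edges up to now, for the starting point `x`. -/
noncomputable def stepKernel (M : MarkovSystem K V E) (x : K) (n : ℕ) :
    Kernel (Finset.Iic n → E) E where
  toFun h := M.edgeLaw (M.orbit x (prolong h) (n + 1))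
  measurable' := measurable_of_finite _

instance (M : MarkovSystem K V E) (x : K) (n : ℕ) : IsMarkovKernel (M.stepKernel x n) :=
  ⟨fun h => inferInstanceAs
    (IsProbabilityMeasure (M.edgeLaw (M.orbit x (prolong h) (n + 1))))⟩

/-- The Borel probability measure `P_x` on `Σ⁺ = E^ℕ`, with the cylinder probabilities given in
`pathMeasure_cylinderSet`. -/
noncomputable def pathMeasure (M : MarkovSystem K V E) (x : K) : Measure (ℕ → E) :=
  Kernel.trajMeasure (X := fun _ => E) (M.edgeLaw x) (M.stepKernel x)

instance (M : MarkovSystem K V E) (x : K) : IsProbabilityMeasure (M.pathMeasure x) :=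
  inferInstanceAs (IsProbabilityMeasure
    (Kernel.trajMeasure (X := fun _ => E) (M.edgeLaw x) (M.stepKernel x)))

/-- `P_x(₁[σ_1, …, σ_n]) = p_{σ_1}(x) p_{σ_2}(w_{σ_1} x) ⋯ p_{σ_n}(w_{σ_{n-1}} ∘ ⋯ ∘ w_{σ_1} x)`. -/
theorem pathMeasure_cylinderSet (M : MarkovSystem K V E) (x : K) (σ : ℕ → E) (n : ℕ) :
    M.pathMeasure x (cylinderSet σ n) =
      ∏ k ∈ Finset.range n, ENNReal.ofReal (M.p (σ k) (M.orbit x σ k)) := by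
  induction n with
  | zero => simp [cylinderSet]
  | succ n ih =>
    rcases n with _ | n
    · have h0 : (M.pathMeasure x).map (Preorder.frestrictLe (π := fun _ => E) 0) =
          (M.edgeLaw x).map (MeasurableEquiv.piUnique (fun _ : Finset.Iic 0 => E)).symm := by
        rw [pathMeasure, Kernel.trajMeasure, Measure.map_comp _ _ (by fun_prop),
          Kernel.traj_map_frestrictLe, Kernel.partialTraj_self, Measure.id_comp]
      have h1 : cylinderSet σ 1 = Preorder.frestrictLe (π := fun _ => E) 0 ⁻¹'
          {h | h ⟨0, Finset.mem_Iic.2 le_rfl⟩ = σ 0} := by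
        ext τ; simp [cylinderSet]
      have hm : MeasurableSet {h : Finset.Iic 0 → E | h ⟨0, Finset.mem_Iic.2 le_rfl⟩ = σ 0} :=
        Set.Finite.measurableSet (Set.toFinite _)
      rw [zero_add, h1, ← Measure.map_apply (by fun_prop) hm, h0,
        Measure.map_apply (by fun_prop) hm]
      have h2 : (MeasurableEquiv.piUnique (fun _ : Finset.Iic 0 => E)).symm ⁻¹'
          {h : Finset.Iic 0 → E | h ⟨0, Finset.mem_Iic.2 le_rfl⟩ = σ 0} = {σ 0} := by
        ext e; rfl
      rw [h2, edgeLaw_singleton]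
      simp [orbit]
    · have key := Kernel.map_frestrictLe_trajMeasure_compProd_eq_map_trajMeasure
        (X := fun _ => E) (κ := M.stepKernel x) (μ₀ := M.edgeLaw x) (a := n)
      have hA : MeasurableSet ({Preorder.frestrictLe (π := fun _ => E) n σ} :
          Set (Finset.Iic n → E)) := Set.Finite.measurableSet (Set.toFinite _)
      have hB : MeasurableSet ({σ (n + 1)} : Set E) := .of_discrete
      have e1 : cylinderSet σ (n + 1) =
          Preorder.frestrictLe (π := fun _ => E) n ⁻¹' {Preorder.frestrictLe n σ} := by
        ext τ
        simp only [cylinderSet, Set.mem_ofPred_eq, Set.mem_preimage, Set.mem_singleton_iff,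
          funext_iff, Preorder.frestrictLe_apply, Subtype.forall, Finset.mem_Iic, Nat.lt_succ_iff]
      have e2 : cylinderSet σ (n + 1 + 1) =
          (fun τ : ℕ → E => (Preorder.frestrictLe (π := fun _ => E) n τ, τ (n + 1))) ⁻¹'
            ({Preorder.frestrictLe n σ} ×ˢ {σ (n + 1)}) := by
        ext τ
        have : τ ∈ cylinderSet σ (n + 1) ↔ Preorder.frestrictLe (π := fun _ => E) n τ =
            Preorder.frestrictLe n σ := by rw [e1]; rfl
        simp only [Set.mem_preimage, Set.mem_prod, Set.mem_singleton_iff, ← this]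
        constructor
        · exact fun h => ⟨fun k hk => h k (by omega), h _ (by omega)⟩
        · rintro ⟨h, h'⟩ k hk
          rcases Nat.lt_succ_iff_lt_or_eq.1 hk with hk | rfl
          exacts [h k hk, h']
      have e3 : M.stepKernel x n (Preorder.frestrictLe (π := fun _ => E) n σ) {σ (n + 1)} =
          ENNReal.ofReal (M.p (σ (n + 1)) (M.orbit x σ (n + 1))) := by
        change M.edgeLaw (M.orbit x (prolong (Preorder.frestrictLe (π := fun _ => E) n σ))
          (n + 1)) {σ (n + 1)} = _
        rw [edgeLaw_singleton, M.orbit_congr x (τ := σ)]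
        intro k hk
        simp [prolong, min_eq_left (Nat.lt_succ_iff.1 hk)]
      rw [Finset.prod_range_succ, ← ih, e2, pathMeasure, ← Measure.map_apply (by fun_prop)
        (hA.prod hB), ← key, Measure.compProd_apply_prod hA hB, Measure.restrict_singleton,
        lintegral_smul_measure, lintegral_dirac, e3, Measure.map_apply (by fun_prop) hA, ← e1,
        smul_eq_mul]

end PathMeasure

end MarkovSystem

/-! By the product formula, the logarithm of the cylinder probability is the sum of `log p` along
the path, which splits into martingale differences plus the conditional means `g = ∑ₑ pₑ log pₑ` at
the visited points. Since the `pₑ` are bounded away from zero on their vertex sets, the differences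
are bounded and `g` is bounded; since the vertex sets are clopen, `g` is continuous.

The martingale part is `o(n)` (`ae_tendsto_sum_sub_mean`): exponential functionals of mean at most
one, Markov's inequality and Borel–Cantelli (`ae_eventually_sum_le`).

The averages of `g` converge to `∫ g dμ` from every starting point (`ae_tendsto_average_integral`).
By the martingale law, `g` may be replaced along the path by a Cesàro mean of its iterates under
`U`. These means are uniformly close to `∫ g dμ` on any set of starting points whose averaged laws
are tight: a limit of the laws is invariant, hence equal to `μ` (`exists_abs_cesaro_sub_le`). For
compact `K` that set is all of `K`. In the contractive case it is a set of bounded distance to the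
base points: contraction gives tightness (`ContractsBy.isTightMeasureSet_cesaroLaw`), and a
logarithmic Lyapunov function shows that paths rarely leave it
(`ContractsBy.exists_ae_eventually_sum_indicator_le`). -/

namespace MarkovSystem

/-! ### Exponential functionals and the strong law along paths. -/

section Paths

open scoped ENNReal

variable {K V E : Type*} [MeasurableSpace K] [Fintype V] [Fintype E]

theorem orbit_succ_shift (M : MarkovSystem K V E) (x : K) (σ : ℕ → E) (n : ℕ) :
    M.orbit x σ (n + 1) = M.orbit (M.w (σ 0) x) (fun k => σ (k + 1)) n := by
  induction n with
  | zero => rfl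
  | succ n ih =>
    rw [orbit, ih]
    rfl

/-- A word of length `n`, prolonged to a sequence by a fixed letter. -/
def wordExtend (e₀ : E) {n : ℕ} (u : Fin n → E) (k : ℕ) : E :=
  if h : k < n then u ⟨k, h⟩ else e₀

/-- If the weights `ψ` have total mass at most one at each point, so have the words of length `n`. -/
theorem sum_words_prod_le_one (M : MarkovSystem K V E) (e₀ : E) (ψ : E → K → ℝ≥0∞)
    (hψ : ∀ y, ∑ e, ψ e y ≤ 1) (n : ℕ) (x : K) :
    ∑ u : Fin n → E, ∏ k ∈ Finset.range n,
      ψ (wordExtend e₀ u k) (M.orbit x (wordExtend e₀ u) k) ≤ 1 := by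
  induction n generalizing x with
  | zero => simp
  | succ n ih =>
    -- Splitting off the first letter `e` leaves a word of length `n` read from `w e x`, so the
    -- induction runs over all starting points.
    rw [← (Fin.consEquiv fun _ => E).sum_comp, Fintype.sum_prod_type]
    have h0 (e : E) (u : Fin n → E) : wordExtend e₀ (Fin.consEquiv (fun _ => E) (e, u)) 0 = e := by
      simp [wordExtend, Fin.consEquiv]
    have hs (e : E) (u : Fin n → E) :
        (fun k => wordExtend e₀ (Fin.consEquiv (fun _ => E) (e, u)) (k + 1)) =
          wordExtend e₀ u := by
      ext k
      by_cases h : k < n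
      · have : (⟨k + 1, Nat.succ_lt_succ h⟩ : Fin (n + 1)) = Fin.succ ⟨k, h⟩ := rfl
        simp [wordExtend, h, Fin.consEquiv, this, -Fin.succ_mk]
      · simp [wordExtend, h]
    have hprod (e : E) (u : Fin n → E) :
        ∏ k ∈ Finset.range (n + 1), ψ (wordExtend e₀ (Fin.consEquiv (fun _ => E) (e, u)) k)
          (M.orbit x (wordExtend e₀ (Fin.consEquiv (fun _ => E) (e, u))) k) =
        ψ e x * ∏ k ∈ Finset.range n,
          ψ (wordExtend e₀ u k) (M.orbit (M.w e x) (wordExtend e₀ u) k) := by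
      rw [Finset.prod_range_succ', mul_comm, h0]
      congr 1
      refine Finset.prod_congr rfl fun k _ => ?_
      rw [orbit_succ_shift, hs, h0]
      exact congrArg (fun e' => ψ e' _) (congrFun (hs e u) k)
    simp_rw [hprod, ← Finset.mul_sum]
    exact (Finset.sum_le_sum fun e _ => mul_le_of_le_one_right' (ih (M.w e x))).trans (hψ x)

/-- Only the first `n` letters matter, so path functionals live on a finite set of words: they are
measurable for arbitrary `φ`, and their integrals are finite sums. -/
theorem pathProd_eq (M : MarkovSystem K V E) (φ : E → K → ℝ≥0∞) (x : K) (n : ℕ) (e₀ : E)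
    (σ : ℕ → E) :
    ∏ k ∈ Finset.range n, φ (σ k) (M.orbit x σ k) =
      ∏ k ∈ Finset.range n, φ (wordExtend e₀ (fun i : Fin n => σ i) k)
        (M.orbit x (wordExtend e₀ (fun i : Fin n => σ i)) k) := by
  have h : ∀ k < n, wordExtend e₀ (fun i : Fin n => σ i) k = σ k := fun k hk => by
    simp [wordExtend, hk]
  refine Finset.prod_congr rfl fun k hk => ?_
  have hk := Finset.mem_range.1 hk
  rw [h k hk, M.orbit_congr x fun j hj => h j (hj.trans hk)]

theorem abs_sum_p_mul_le (M : MarkovSystem K V E) {h : E → K → ℝ} {B : ℝ}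
    (hB : ∀ e y, |h e y| ≤ B) (y : K) : |∑ e, M.p e y * h e y| ≤ B := by
  calc |∑ e, M.p e y * h e y| ≤ ∑ e, |M.p e y * h e y| := Finset.abs_sum_le_sum_abs _ _
    _ ≤ ∑ e, M.p e y * B := Finset.sum_le_sum fun e _ => by
        rw [abs_mul, abs_of_nonneg (M.p_nonneg e y)]
        exact mul_le_mul_of_nonneg_left (hB e y) (M.p_nonneg e y)
    _ = B := by rw [← Finset.sum_mul, M.sum_p, one_mul]

theorem nonempty_edges (M : MarkovSystem K V E) (x : K) : Nonempty E := by
  by_contra h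
  rw [not_nonempty_iff] at h
  simpa using M.sum_p x

variable [MeasurableSpace E] [DiscreteMeasurableSpace E]

theorem measurable_prod_orbit (M : MarkovSystem K V E) (φ : E → K → ℝ≥0∞) (x : K) (n : ℕ) :
    Measurable (fun σ : ℕ → E => ∏ k ∈ Finset.range n, φ (σ k) (M.orbit x σ k)) := by
  rcases isEmpty_or_nonempty E with hE | ⟨⟨e₀⟩⟩
  · exact measurable_of_empty _
  rw [funext fun σ => M.pathProd_eq φ x n e₀ σ]
  exact (measurable_of_finite fun u : Fin n → E => ∏ k ∈ Finset.range n,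
    φ (wordExtend e₀ u k) (M.orbit x (wordExtend e₀ u) k)).comp
    (measurable_pi_lambda _ fun i => measurable_pi_apply _)

/-- The multiplicative functional attached to weights of conditional mean at most one has mean at
most one. -/
theorem lintegral_prod_orbit_le_one (M : MarkovSystem K V E) (φ : E → K → ℝ≥0∞)
    (hφ : ∀ y, ∑ e, ENNReal.ofReal (M.p e y) * φ e y ≤ 1) (x : K) (n : ℕ) :
    ∫⁻ σ, ∏ k ∈ Finset.range n, φ (σ k) (M.orbit x σ k) ∂(M.pathMeasure x) ≤ 1 := by
  obtain ⟨e₀⟩ := M.nonempty_edges x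
  have hr : Measurable (fun (σ : ℕ → E) (i : Fin n) => σ i) :=
    measurable_pi_lambda _ fun i => measurable_pi_apply _
  rw [lintegral_congr fun σ => M.pathProd_eq φ x n e₀ σ, ← lintegral_map (f := fun u : Fin n → E => ∏ k ∈ Finset.range n,
      φ (wordExtend e₀ u k) (M.orbit x (wordExtend e₀ u) k)) (measurable_of_finite _) hr,
    lintegral_fintype]
  refine le_trans (le_of_eq (Finset.sum_congr rfl fun u _ => ?_))
    (M.sum_words_prod_le_one e₀ (fun e y => ENNReal.ofReal (M.p e y) * φ e y) hφ n x)
  have hpre : (fun (σ : ℕ → E) (i : Fin n) => σ i) ⁻¹' {u} = cylinderSet (wordExtend e₀ u) n := by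
    ext σ
    simp only [Set.mem_preimage, Set.mem_singleton_iff, cylinderSet, Set.mem_ofPred_eq, funext_iff]
    constructor
    · intro h k hk
      simp [wordExtend, hk, ← h ⟨k, hk⟩]
    · intro h i
      simp [wordExtend, h i i.2]
  rw [Measure.map_apply hr (Set.Finite.measurableSet (Set.toFinite _)), hpre,
    pathMeasure_cylinderSet, Finset.prod_mul_distrib, mul_comm]

/-- Since `0 * ⊤ = 0`, giving edges of probability zero the weight `⊤` keeps the conditional mean at
one. The resulting functional has finite integral, hence is almost surely finite, and no such edge
is ever taken. -/
theorem ae_p_orbit_ne_zero (M : MarkovSystem K V E) (x : K) :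
    ∀ᵐ σ ∂(M.pathMeasure x), ∀ k, M.p (σ k) (M.orbit x σ k) ≠ 0 := by
  classical
  let φ : E → K → ℝ≥0∞ := fun e y => if M.p e y = 0 then ⊤ else 1
  have hφ (y : K) : ∑ e, ENNReal.ofReal (M.p e y) * φ e y ≤ 1 := by
    have (e : E) : ENNReal.ofReal (M.p e y) * φ e y = ENNReal.ofReal (M.p e y) := by
      by_cases h : M.p e y = 0 <;> simp [φ, h]
    simp_rw [this]
    rw [← ENNReal.ofReal_sum_of_nonneg fun e _ => M.p_nonneg e y, M.sum_p, ENNReal.ofReal_one]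
  have hfin : ∀ᵐ σ ∂(M.pathMeasure x), ∀ n,
      ∏ k ∈ Finset.range n, φ (σ k) (M.orbit x σ k) < ⊤ := by
    refine ae_all_iff.2 fun n => ae_lt_top (M.measurable_prod_orbit φ x n) ?_
    exact ((M.lintegral_prod_orbit_le_one φ hφ x n).trans_lt ENNReal.one_lt_top).ne
  filter_upwards [hfin] with σ hσ k hk
  have hle := Finset.single_le_prod' (s := Finset.range (k + 1))
    (f := fun k => φ (σ k) (M.orbit x σ k))
    (fun i _ => by by_cases h : M.p (σ i) (M.orbit x σ i) = 0 <;> simp [φ, h])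
    (Finset.self_mem_range_succ k)
  have : φ (σ k) (M.orbit x σ k) = ⊤ := by simp [φ, hk]
  exact absurd (hle.trans_lt (hσ (k + 1))) (by simp [this])

/-- Sums along paths grow sublinearly if the exponential of the summand has conditional mean at most
one. -/
theorem ae_eventually_sum_le (M : MarkovSystem K V E) (ψ : E → K → ℝ)
    (hψ : ∀ y, ∑ e, M.p e y * Real.exp (ψ e y) ≤ 1) (x : K) {η : ℝ} (hη : 0 < η) :
    ∀ᵐ σ ∂(M.pathMeasure x), ∀ᶠ n : ℕ in atTop,
      ∑ k ∈ Finset.range n, ψ (σ k) (M.orbit x σ k) ≤ η * n := by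
  let φ : E → K → ℝ≥0∞ := fun e y => ENNReal.ofReal (Real.exp (ψ e y))
  have hφ (y : K) : ∑ e, ENNReal.ofReal (M.p e y) * φ e y ≤ 1 := by
    simp_rw [φ, ← ENNReal.ofReal_mul (M.p_nonneg _ y)]
    rw [← ENNReal.ofReal_sum_of_nonneg fun e _ => mul_nonneg (M.p_nonneg e y) (Real.exp_pos _).le]
    simpa using hψ y
  have hprod (σ : ℕ → E) (n : ℕ) : ∏ k ∈ Finset.range n, φ (σ k) (M.orbit x σ k) =
      ENNReal.ofReal (Real.exp (∑ k ∈ Finset.range n, ψ (σ k) (M.orbit x σ k))) := by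
    rw [Real.exp_sum, ENNReal.ofReal_prod_of_nonneg fun _ _ => (Real.exp_pos _).le]
  let s : ℕ → Set (ℕ → E) := fun n => {σ | ENNReal.ofReal (Real.exp (η * n)) ≤
    ∏ k ∈ Finset.range n, φ (σ k) (M.orbit x σ k)}
  -- Markov's inequality; the geometric bound feeds Borel–Cantelli.
  have hs (n : ℕ) : M.pathMeasure x (s n) ≤ ENNReal.ofReal (Real.exp (-η) ^ n) := by
    have h1 := mul_meas_ge_le_lintegral (μ := M.pathMeasure x) (M.measurable_prod_orbit φ x n)
      (ENNReal.ofReal (Real.exp (η * n)))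
    have h2 := h1.trans (M.lintegral_prod_orbit_le_one φ hφ x n)
    have h3 : ENNReal.ofReal (Real.exp (-η) ^ n) = (ENNReal.ofReal (Real.exp (η * n)))⁻¹ := by
      rw [← ENNReal.ofReal_inv_of_pos (Real.exp_pos _), ← Real.exp_neg, ← Real.exp_nat_mul]
      congr 2
      ring
    rw [h3, ← one_div, ENNReal.le_div_iff_mul_le (by simp [Real.exp_pos]) (by simp), mul_comm]
    exact h2
  have hsum : ∑' n, M.pathMeasure x (s n) ≠ ⊤ := by
    have hsm : Summable fun n : ℕ => Real.exp (-η) ^ n :=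
      summable_geometric_of_lt_one (Real.exp_pos _).le (by simpa using hη)
    exact ((ENNReal.tsum_le_tsum hs).trans_lt hsm.tsum_ofReal_lt_top).ne
  filter_upwards [ae_eventually_notMem hsum] with σ hσ
  filter_upwards [hσ] with n hn
  simp only [s, Set.mem_ofPred_eq, hprod, not_le] at hn
  exact (Real.exp_lt_exp.1 ((ENNReal.ofReal_lt_ofReal_iff (Real.exp_pos _)).1 hn)).le

theorem ae_eventually_sum_sub_mean_le (M : MarkovSystem K V E) (h : E → K → ℝ) {B : ℝ}
    (hB : ∀ e y, |h e y| ≤ B) (x : K) {η : ℝ} (hη : 0 < η) :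
    ∀ᵐ σ ∂(M.pathMeasure x), ∀ᶠ n : ℕ in atTop,
      ∑ k ∈ Finset.range n, (h (σ k) (M.orbit x σ k) -
        ∑ e, M.p e (M.orbit x σ k) * h e (M.orbit x σ k)) ≤ η * n := by
  obtain ⟨e₀⟩ := M.nonempty_edges x
  have hB0 : 0 ≤ B := (abs_nonneg _).trans (hB e₀ x)
  set D : E → K → ℝ := fun e y => h e y - ∑ e', M.p e' y * h e' y with hD
  have hDB (e : E) (y : K) : |D e y| ≤ 2 * B := by
    calc |D e y| ≤ |h e y| + |∑ e', M.p e' y * h e' y| := abs_sub _ _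
      _ ≤ 2 * B := by linarith [hB e y, M.abs_sum_p_mul_le hB y]
  have hDmean (y : K) : ∑ e, M.p e y * D e y = 0 := by
    simp only [hD, mul_sub, Finset.sum_sub_distrib, ← Finset.sum_mul, M.sum_p, one_mul, sub_self]
  set C : ℝ := (2 * B) ^ 2 with hC
  have hC0 : 0 ≤ C := sq_nonneg _
  -- The first bound gives `|t D| ≤ 1`, where `exp s ≤ 1 + s + s²` applies. The second absorbs the
  -- final rate `t (C + 1)`: `t C` from the quadratic correction and `t` from the choice of `t ^ 2`
  -- as the growth rate below.
  set t : ℝ := min (1 / (2 * B + 1)) (η / (C + 1)) with ht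
  have ht0 : 0 < t := lt_min (by positivity) (by positivity)
  have ht1 : t * (2 * B) ≤ 1 := by
    have h1 : t ≤ 1 / (2 * B + 1) := min_le_left _ _
    rw [le_div_iff₀ (by positivity)] at h1
    linarith
  have ht2 : t * (C + 1) ≤ η := by
    have h1 : t ≤ η / (C + 1) := min_le_right _ _
    rwa [le_div_iff₀ (by positivity)] at h1
  have key (y : K) : ∑ e, M.p e y * Real.exp (t * D e y - t ^ 2 * C) ≤ 1 := by
    have h1 (e : E) : Real.exp (t * D e y) ≤ 1 + t * D e y + t ^ 2 * C := by
      have habs : |t * D e y| ≤ 1 := by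
        rw [abs_mul, abs_of_pos ht0]
        exact (mul_le_mul_of_nonneg_left (hDB e y) ht0.le).trans ht1
      have h2 := (abs_le.1 (Real.abs_exp_sub_one_sub_id_le habs)).2
      have h3 : (t * D e y) ^ 2 ≤ t ^ 2 * C := by
        rw [mul_pow, hC]
        exact mul_le_mul_of_nonneg_left (sq_le_sq' (abs_le.1 (hDB e y)).1 (abs_le.1 (hDB e y)).2)
          (sq_nonneg t)
      linarith
    calc ∑ e, M.p e y * Real.exp (t * D e y - t ^ 2 * C)
        = Real.exp (-(t ^ 2 * C)) * ∑ e, M.p e y * Real.exp (t * D e y) := by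
          rw [Finset.mul_sum]
          refine Finset.sum_congr rfl fun e _ => ?_
          rw [sub_eq_add_neg, Real.exp_add]
          ring
      _ ≤ Real.exp (-(t ^ 2 * C)) * ∑ e, M.p e y * (1 + t * D e y + t ^ 2 * C) := by
          gcongr with e
          · exact M.p_nonneg e y
          · exact h1 e
      _ = Real.exp (-(t ^ 2 * C)) * (1 + t ^ 2 * C) := by
          congr 1
          calc ∑ e, M.p e y * (1 + t * D e y + t ^ 2 * C)
              = ∑ e, (M.p e y * (1 + t ^ 2 * C) + t * (M.p e y * D e y)) :=
                Finset.sum_congr rfl fun e _ => by ring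
            _ = 1 + t ^ 2 * C := by
                rw [Finset.sum_add_distrib, ← Finset.sum_mul, ← Finset.mul_sum, hDmean, M.sum_p]
                ring
      _ ≤ Real.exp (-(t ^ 2 * C)) * Real.exp (t ^ 2 * C) := by
          gcongr
          linarith [Real.add_one_le_exp (t ^ 2 * C)]
      _ = 1 := by rw [← Real.exp_add]; simp
  filter_upwards [M.ae_eventually_sum_le _ key x (show 0 < t ^ 2 by positivity)] with σ hσ
  filter_upwards [hσ] with n hn
  rw [Finset.sum_sub_distrib, ← Finset.mul_sum, Finset.sum_const, Finset.card_range,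
    nsmul_eq_mul] at hn
  have h4 : t * ∑ k ∈ Finset.range n, D (σ k) (M.orbit x σ k) ≤ t * (t * (C + 1) * n) := by
    nlinarith
  exact (le_of_mul_le_mul_left h4 ht0).trans (mul_le_mul_of_nonneg_right ht2 n.cast_nonneg)

/-- The strong law of large numbers for bounded martingale differences along a path. -/
theorem ae_tendsto_sum_sub_mean (M : MarkovSystem K V E) (h : E → K → ℝ) {B : ℝ}
    (hB : ∀ e y, |h e y| ≤ B) (x : K) :
    ∀ᵐ σ ∂(M.pathMeasure x), Tendsto (fun n : ℕ =>
      (∑ k ∈ Finset.range n, (h (σ k) (M.orbit x σ k) -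
        ∑ e, M.p e (M.orbit x σ k) * h e (M.orbit x σ k))) / n) atTop (𝓝 0) := by
  have h1 : ∀ᵐ σ ∂(M.pathMeasure x), ∀ q : ℕ, ∀ᶠ n : ℕ in atTop,
      |∑ k ∈ Finset.range n, (h (σ k) (M.orbit x σ k) -
        ∑ e, M.p e (M.orbit x σ k) * h e (M.orbit x σ k))| ≤ 1 / ((q : ℝ) + 1) * n := by
    refine ae_all_iff.2 fun q => ?_
    have hq : (0 : ℝ) < 1 / ((q : ℝ) + 1) := by positivity
    filter_upwards [M.ae_eventually_sum_sub_mean_le h hB x hq,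
      M.ae_eventually_sum_sub_mean_le (fun e y => -h e y) (B := B) (by simpa using hB) x hq]
      with σ h1 h2
    filter_upwards [h1, h2] with n h1 h2
    refine abs_le.2 ⟨?_, h1⟩
    rw [neg_le, ← Finset.sum_neg_distrib]
    refine le_trans (le_of_eq (Finset.sum_congr rfl fun k _ => ?_)) h2
    simp only [mul_neg, Finset.sum_neg_distrib]
    ring
  filter_upwards [h1] with σ hσ
  rw [Metric.tendsto_nhds]
  intro ε hε
  obtain ⟨q, hq⟩ := exists_nat_one_div_lt hε
  filter_upwards [hσ q, eventually_gt_atTop 0] with n hn hn0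
  have hn0 : (0 : ℝ) < n := by exact_mod_cast hn0
  rw [Real.dist_eq, sub_zero, abs_div, abs_of_pos hn0, div_lt_iff₀ hn0]
  exact hn.trans_lt (mul_lt_mul_of_pos_right hq hn0)

end Paths

/-! ### Iterates of `U`, their Cesàro means and path averages. -/

section OperatorAlgebra

variable {K V E : Type*} [MeasurableSpace K] [Fintype V] [Fintype E]

theorem U_mono (M : MarkovSystem K V E) : Monotone M.U := fun _ _ h y =>
  Finset.sum_le_sum fun e _ => mul_le_mul_of_nonneg_left (h (M.w e y)) (M.p_nonneg e y)

theorem U_affine (M : MarkovSystem K V E) (f : K → ℝ) (a c : ℝ) :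
    M.U (fun y => a * f y + c) = fun y => a * M.U f y + c := by
  ext y
  simp only [U, mul_add, Finset.sum_add_distrib, ← Finset.sum_mul, M.sum_p, one_mul,
    Finset.mul_sum]
  congr 1
  exact Finset.sum_congr rfl fun e _ => by ring

theorem iterate_U_mono (M : MarkovSystem K V E) (j : ℕ) : Monotone (M.U^[j]) :=
  M.U_mono.iterate j

theorem iterate_U_affine (M : MarkovSystem K V E) (f : K → ℝ) (a c : ℝ) (j : ℕ) :
    M.U^[j] (fun y => a * f y + c) = fun y => a * M.U^[j] f y + c := by
  induction j with
  | zero => rfl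
  | succ j ih => simp only [Function.iterate_succ_apply', ih, U_affine]

theorem iterate_U_const (M : MarkovSystem K V E) (c : ℝ) (j : ℕ) :
    M.U^[j] (fun _ => c) = fun _ => c := by
  simpa using M.iterate_U_affine (fun _ => 0) 0 c j

theorem abs_iterate_U_le (M : MarkovSystem K V E) {f : K → ℝ} {B : ℝ} (hf : ∀ y, |f y| ≤ B)
    (j : ℕ) (y : K) : |M.U^[j] f y| ≤ B := by
  rw [abs_le]
  constructor
  · have := M.iterate_U_mono j (show (fun _ => -B) ≤ f from fun y => (abs_le.1 (hf y)).1) y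
    rwa [iterate_U_const] at this
  · have := M.iterate_U_mono j (show f ≤ fun _ => B from fun y => (abs_le.1 (hf y)).2) y
    rwa [iterate_U_const] at this

/-- The average of `U ^ j f` over `m < j ≤ 2 m + 1`. -/
noncomputable def cesaro (M : MarkovSystem K V E) (m : ℕ) (f : K → ℝ) (y : K) : ℝ :=
  (∑ j ∈ Finset.range (m + 1), M.U^[m + 1 + j] f y) / (m + 1)

theorem abs_cesaro_le (M : MarkovSystem K V E) {f : K → ℝ} {B : ℝ} (hf : ∀ y, |f y| ≤ B)
    (m : ℕ) (y : K) : |M.cesaro m f y| ≤ B := by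
  have hm : (0 : ℝ) < m + 1 := by positivity
  rw [cesaro, abs_div, abs_of_pos hm, div_le_iff₀ hm]
  calc |∑ j ∈ Finset.range (m + 1), M.U^[m + 1 + j] f y|
      ≤ ∑ j ∈ Finset.range (m + 1), |M.U^[m + 1 + j] f y| := Finset.abs_sum_le_sum_abs _ _
    _ ≤ ∑ _j ∈ Finset.range (m + 1), B := Finset.sum_le_sum fun j _ => M.abs_iterate_U_le hf _ y
    _ = B * (m + 1) := by simp [mul_comm]

/-- The sum telescopes to two terms; this makes limits of the averaged laws invariant. -/
theorem abs_cesaro_U_sub_le (M : MarkovSystem K V E) {f : K → ℝ} {B : ℝ} (hf : ∀ y, |f y| ≤ B)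
    (m : ℕ) (y : K) : |M.cesaro m (M.U f) y - M.cesaro m f y| ≤ 2 * B / (m + 1) := by
  have hm : (0 : ℝ) < m + 1 := by positivity
  have h : ∑ j ∈ Finset.range (m + 1), M.U^[m + 1 + j] (M.U f) y -
      ∑ j ∈ Finset.range (m + 1), M.U^[m + 1 + j] f y =
      M.U^[m + 1 + (m + 1)] f y - M.U^[m + 1] f y := by
    simp only [← Function.iterate_succ_apply]
    rw [← Finset.sum_sub_distrib]
    exact Finset.sum_range_sub (fun j => M.U^[m + 1 + j] f y) (m + 1)
  rw [cesaro, cesaro, ← sub_div, h, abs_div, abs_of_pos hm]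
  gcongr
  calc _ ≤ |M.U^[m + 1 + (m + 1)] f y| + |M.U^[m + 1] f y| := abs_sub _ _
    _ ≤ 2 * B := by linarith [M.abs_iterate_U_le hf (m + 1 + (m + 1)) y,
        M.abs_iterate_U_le hf (m + 1) y]

variable [MeasurableSpace E] [DiscreteMeasurableSpace E]

/-- With `x_k` the orbit, `U f (x_k) - f (x_k)` is the telescoping increment `f (x_{k+1}) - f (x_k)`
minus the martingale difference `f (x_{k+1}) - U f (x_k)`. -/
theorem ae_tendsto_sum_U_sub (M : MarkovSystem K V E) {f : K → ℝ} {B : ℝ}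
    (hf : ∀ y, |f y| ≤ B) (x : K) :
    ∀ᵐ σ ∂(M.pathMeasure x), Tendsto (fun n : ℕ => (∑ k ∈ Finset.range n,
      (M.U f (M.orbit x σ k) - f (M.orbit x σ k))) / n) atTop (𝓝 0) := by
  filter_upwards [M.ae_tendsto_sum_sub_mean (fun e y => f (M.w e y))
    (fun e y => hf (M.w e y)) x] with σ hσ
  have hbd : Tendsto (fun n : ℕ => (f (M.orbit x σ n) - f (M.orbit x σ 0)) / n) atTop (𝓝 0) := by
    refine squeeze_zero_norm (fun n => ?_)
      (tendsto_const_div_atTop_nhds_zero_nat (2 * B))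
    rw [norm_div, Real.norm_natCast, Real.norm_eq_abs]
    gcongr
    calc _ ≤ |f (M.orbit x σ n)| + |f (M.orbit x σ 0)| := abs_sub _ _
      _ ≤ 2 * B := by linarith [hf (M.orbit x σ n), hf (M.orbit x σ 0)]
  have := hbd.sub hσ
  rw [sub_zero] at this
  refine this.congr fun n => ?_
  rw [← sub_div, ← Finset.sum_range_sub (fun k => f (M.orbit x σ k)) n, ← Finset.sum_sub_distrib]
  congr 1
  refine Finset.sum_congr rfl fun k _ => ?_
  simp only [orbit, U]
  ring

theorem ae_tendsto_sum_iterate_U_sub (M : MarkovSystem K V E) {f : K → ℝ} {B : ℝ}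
    (hf : ∀ y, |f y| ≤ B) (x : K) (j : ℕ) :
    ∀ᵐ σ ∂(M.pathMeasure x), Tendsto (fun n : ℕ => (∑ k ∈ Finset.range n,
      (M.U^[j] f (M.orbit x σ k) - f (M.orbit x σ k))) / n) atTop (𝓝 0) := by
  induction j with
  | zero => simp
  | succ j ih =>
    filter_upwards [ih, M.ae_tendsto_sum_U_sub (M.abs_iterate_U_le hf j) x] with σ h1 h2
    have := h2.add h1
    rw [add_zero] at this
    refine this.congr fun n => ?_
    rw [← add_div, ← Finset.sum_add_distrib]
    congr 1
    refine Finset.sum_congr rfl fun k _ => ?_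
    rw [Function.iterate_succ_apply']
    ring

theorem ae_tendsto_sum_cesaro_sub (M : MarkovSystem K V E) {f : K → ℝ} {B : ℝ}
    (hf : ∀ y, |f y| ≤ B) (x : K) (m : ℕ) :
    ∀ᵐ σ ∂(M.pathMeasure x), Tendsto (fun n : ℕ => (∑ k ∈ Finset.range n,
      (M.cesaro m f (M.orbit x σ k) - f (M.orbit x σ k))) / n) atTop (𝓝 0) := by
  filter_upwards [ae_all_iff.2 fun j => M.ae_tendsto_sum_iterate_U_sub hf x j] with σ hσ
  have h := (tendsto_finsetSum (Finset.range (m + 1)) fun j _ => hσ (m + 1 + j)).div_const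
    ((m : ℝ) + 1)
  simp only [Finset.sum_const_zero, zero_div] at h
  refine h.congr fun n => ?_
  rw [← Finset.sum_div, Finset.sum_comm, div_right_comm, Finset.sum_div]
  congr 1
  refine Finset.sum_congr rfl fun k _ => ?_
  have hm : (m : ℝ) + 1 ≠ 0 := by positivity
  rw [cesaro, Finset.sum_sub_distrib, Finset.sum_const, Finset.card_range, nsmul_eq_mul]
  push_cast
  field_simp

/-- Ergodic averages along paths converge if the Cesàro means converge uniformly on sets which the
paths leave with small frequency only. -/
theorem ae_tendsto_average (M : MarkovSystem K V E) {f : K → ℝ} {B : ℝ}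
    (hf : ∀ y, |f y| ≤ B) (x : K) (c : ℝ)
    (H : ∀ η : ℝ, 0 < η → ∃ S : Set K, (∀ ε : ℝ, 0 < ε → ∃ m, ∀ y ∈ S, |M.cesaro m f y - c| ≤ ε) ∧
      ∀ᵐ σ ∂(M.pathMeasure x), ∀ᶠ n : ℕ in atTop,
        ∑ k ∈ Finset.range n, Sᶜ.indicator (fun _ => (1 : ℝ)) (M.orbit x σ k) ≤ η * n) :
    ∀ᵐ σ ∂(M.pathMeasure x), Tendsto (fun n : ℕ => (∑ k ∈ Finset.range n,
      f (M.orbit x σ k)) / n) atTop (𝓝 c) := by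
  set D : ℝ := B + |c| with hD
  have hD0 : 0 ≤ D := add_nonneg ((abs_nonneg _).trans (hf x)) (abs_nonneg c)
  -- With `η = 1 / (q + 1)`, the error is `η` on `S`, `D * η` for the visits outside `S`, and `η`
  -- for replacing `f` by its Cesàro mean.
  have h1 : ∀ᵐ σ ∂(M.pathMeasure x), ∀ q : ℕ, ∀ᶠ n : ℕ in atTop,
      |∑ k ∈ Finset.range n, (f (M.orbit x σ k) - c)| ≤ (2 + D) * (1 / ((q : ℝ) + 1)) * n := by
    refine ae_all_iff.2 fun q => ?_
    have hq : (0 : ℝ) < 1 / ((q : ℝ) + 1) := by positivity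
    set η : ℝ := 1 / ((q : ℝ) + 1)
    obtain ⟨S, hS, hfreq⟩ := H η hq
    obtain ⟨m, hm⟩ := hS η hq
    have hpt (y : K) : |M.cesaro m f y - c| ≤ η + D * Sᶜ.indicator (fun _ => (1 : ℝ)) y := by
      by_cases hy : y ∈ S
      · simpa [hy] using hm y hy
      · have : |M.cesaro m f y - c| ≤ D :=
          (abs_sub _ _).trans (add_le_add_left (M.abs_cesaro_le hf m y) |c|)
        simp only [Set.mem_compl_iff, hy, not_false_eq_true, Set.indicator_of_mem, mul_one]
        linarith
    filter_upwards [hfreq, M.ae_tendsto_sum_cesaro_sub hf x m] with σ h2 h3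
    filter_upwards [h2, (Metric.tendsto_nhds.1 h3) η hq, eventually_gt_atTop 0] with n h2 h3 hn0
    have hn0 : (0 : ℝ) < n := by exact_mod_cast hn0
    rw [Real.dist_eq, sub_zero, abs_div, abs_of_pos hn0, div_lt_iff₀ hn0] at h3
    have h4 : |∑ k ∈ Finset.range n, (M.cesaro m f (M.orbit x σ k) - c)| ≤
        η * n + D * (η * n) := by
      calc _ ≤ ∑ k ∈ Finset.range n, |M.cesaro m f (M.orbit x σ k) - c| :=
            Finset.abs_sum_le_sum_abs _ _
        _ ≤ ∑ k ∈ Finset.range n,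
            (η + D * Sᶜ.indicator (fun _ => (1 : ℝ)) (M.orbit x σ k)) :=
            Finset.sum_le_sum fun k _ => hpt _
        _ = η * n + D * ∑ k ∈ Finset.range n,
            Sᶜ.indicator (fun _ => (1 : ℝ)) (M.orbit x σ k) := by
            rw [Finset.sum_add_distrib, ← Finset.mul_sum]
            simp [mul_comm]
        _ ≤ _ := by gcongr
    have h5 : ∑ k ∈ Finset.range n, (f (M.orbit x σ k) - c) =
        ∑ k ∈ Finset.range n, (M.cesaro m f (M.orbit x σ k) - c) -
        ∑ k ∈ Finset.range n, (M.cesaro m f (M.orbit x σ k) - f (M.orbit x σ k)) := by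
      rw [← Finset.sum_sub_distrib]
      exact Finset.sum_congr rfl fun k _ => by ring
    rw [h5]
    refine (abs_sub _ _).trans ?_
    linarith
  filter_upwards [h1] with σ hσ
  rw [Metric.tendsto_nhds]
  intro ε hε
  obtain ⟨q, hq⟩ := exists_nat_one_div_lt (div_pos hε (show 0 < 2 + D by positivity))
  rw [lt_div_iff₀ (by positivity), mul_comm] at hq
  filter_upwards [hσ q, eventually_gt_atTop 0] with n hn hn0
  have hn0 : (0 : ℝ) < n := by exact_mod_cast hn0
  have h6 : (∑ k ∈ Finset.range n, f (M.orbit x σ k)) / n - c =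
      (∑ k ∈ Finset.range n, (f (M.orbit x σ k) - c)) / n := by
    rw [Finset.sum_sub_distrib, Finset.sum_const, Finset.card_range, nsmul_eq_mul]
    field_simp
  rw [Real.dist_eq, h6, abs_div, abs_of_pos hn0, div_lt_iff₀ hn0]
  exact hn.trans_lt (mul_lt_mul_of_pos_right hq hn0)

end OperatorAlgebra

/-! ### Laws of the Markov chain. -/

section Law

open scoped ENNReal

variable {K V E : Type*} [MeasurableSpace K] [Fintype V] [Fintype E]

/-- The law of the `j`-th point of the Markov chain started at `y`. -/
noncomputable def law (M : MarkovSystem K V E) : ℕ → K → Measure K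
  | 0, y => Measure.dirac y
  | j + 1, y => ∑ e, ENNReal.ofReal (M.p e y) • M.law j (M.w e y)

instance (M : MarkovSystem K V E) (j : ℕ) (y : K) : IsProbabilityMeasure (M.law j y) := by
  induction j generalizing y with
  | zero => exact inferInstanceAs (IsProbabilityMeasure (Measure.dirac y))
  | succ j ih =>
    constructor
    simp only [law, Measure.coe_finsetSum, Finset.sum_apply, Measure.smul_apply, smul_eq_mul,
      measure_univ, mul_one]
    rw [← ENNReal.ofReal_sum_of_nonneg fun e _ => M.p_nonneg e y, M.sum_p, ENNReal.ofReal_one]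

/-- The law is a finite combination of Dirac masses, so every real function is integrable. -/
theorem integrable_law [MeasurableSingletonClass K] (M : MarkovSystem K V E) (f : K → ℝ) (j : ℕ)
    (y : K) : Integrable f (M.law j y) := by
  induction j generalizing y with
  | zero => exact integrable_dirac (by simp)
  | succ j ih =>
    exact integrable_finsetSum_measure.2 fun e _ => (ih _).smul_measure ENNReal.ofReal_ne_top

theorem integral_law [MeasurableSingletonClass K] (M : MarkovSystem K V E) (f : K → ℝ) (j : ℕ)
    (y : K) : ∫ z, f z ∂(M.law j y) = M.U^[j] f y := by
  induction j generalizing y with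
  | zero => exact integral_dirac f y
  | succ j ih =>
    rw [law, integral_finsetSum_measure fun e _ =>
      (M.integrable_law f j _).smul_measure ENNReal.ofReal_ne_top, Function.iterate_succ_apply', U]
    refine Finset.sum_congr rfl fun e _ => ?_
    rw [integral_smul_measure, ih, ENNReal.toReal_ofReal (M.p_nonneg e y), smul_eq_mul]

/-- The average of the laws of the points with index in `m < j ≤ 2 m + 1`. -/
noncomputable def cesaroLaw (M : MarkovSystem K V E) (m : ℕ) (y : K) : Measure K :=
  ((m : ℝ≥0∞) + 1)⁻¹ • ∑ j ∈ Finset.range (m + 1), M.law (m + 1 + j) y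

instance (M : MarkovSystem K V E) (m : ℕ) (y : K) : IsProbabilityMeasure (M.cesaroLaw m y) := by
  constructor
  simp only [cesaroLaw, Measure.coe_finsetSum, Finset.sum_apply, Measure.smul_apply, smul_eq_mul,
    measure_univ, Finset.sum_const, Finset.card_range, nsmul_eq_mul, mul_one]
  push_cast
  exact ENNReal.inv_mul_cancel (by simp) (by finiteness)

theorem integral_cesaroLaw [MeasurableSingletonClass K] (M : MarkovSystem K V E) (f : K → ℝ)
    (m : ℕ) (y : K) : ∫ z, f z ∂(M.cesaroLaw m y) = M.cesaro m f y := by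
  rw [cesaroLaw, integral_smul_measure, integral_finsetSum_measure fun j _ =>
    M.integrable_law f _ y]
  simp only [integral_law, cesaro, ENNReal.toReal_inv, smul_eq_mul]
  rw [ENNReal.toReal_add (by finiteness) (by finiteness), div_eq_inv_mul]
  simp

end Law

/-! ### Clopen vertex sets and the Feller property. -/

section Feller

variable {K V E : Type*} [MeasurableSpace K] [Fintype V] [Fintype E]

/-- Every vertex set has an outgoing edge. -/
theorem exists_init_eq (M : MarkovSystem K V E) (i : V) : ∃ e, M.init e = i := by
  obtain ⟨y, hy⟩ := M.part_nonempty i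
  by_contra! h
  have h0 (e : E) : M.p e y = 0 := M.p_eq_zero e y fun hy' =>
    Set.disjoint_left.1 (M.pairwise_disjoint_part (h e)) hy' hy
  simpa [h0] using M.sum_p y

variable [TopologicalSpace K]

theorem isOpen_part (M : MarkovSystem K V E) (hopen : ∀ e, IsOpen (M.part (M.init e))) (i : V) :
    IsOpen (M.part i) := by
  obtain ⟨e, rfl⟩ := M.exists_init_eq i
  exact hopen e

theorem isClosed_part (M : MarkovSystem K V E) (hopen : ∀ e, IsOpen (M.part (M.init e))) (i : V) :
    IsClosed (M.part i) := by
  have h : (M.part i)ᶜ = ⋃ j ∈ {j | j ≠ i}, M.part j := by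
    ext y
    simp only [Set.mem_compl_iff, Set.mem_iUnion, Set.mem_ofPred_eq, exists_prop]
    constructor
    · intro hy
      obtain ⟨j, hj⟩ := Set.mem_iUnion.1 (M.iUnion_part.symm ▸ Set.mem_univ y)
      exact ⟨j, fun h => hy (h ▸ hj), hj⟩
    · rintro ⟨j, hji, hj⟩ hy
      exact Set.disjoint_left.1 (M.pairwise_disjoint_part hji) hj hy
  rw [← isOpen_compl_iff, h]
  exact isOpen_biUnion fun j _ => M.isOpen_part hopen j

theorem continuous_of_continuousOn_part (M : MarkovSystem K V E)
    (hopen : ∀ e, IsOpen (M.part (M.init e))) (i : V) {f : K → ℝ}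
    (hf : ContinuousOn f (M.part i)) (h0 : ∀ y ∉ M.part i, f y = 0) : Continuous f := by
  refine continuous_iff_continuousAt.2 fun y => ?_
  by_cases hy : y ∈ M.part i
  · exact hf.continuousAt ((M.isOpen_part hopen i).mem_nhds hy)
  · refine (continuousAt_const (y := (0 : ℝ))).congr ?_
    filter_upwards [(M.isClosed_part hopen i).isOpen_compl.mem_nhds hy] with z hz
    exact (h0 z hz).symm

theorem continuous_p (M : MarkovSystem K V E) (hopen : ∀ e, IsOpen (M.part (M.init e)))
    (hp : ∀ e, ContinuousOn (M.p e) (M.part (M.init e))) (e : E) : Continuous (M.p e) :=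
  M.continuous_of_continuousOn_part hopen (M.init e) (hp e) (M.p_eq_zero e)

/-- The Feller property. -/
theorem continuous_U (M : MarkovSystem K V E) (hopen : ∀ e, IsOpen (M.part (M.init e)))
    (hw : ∀ e, ContinuousOn (M.w e) (M.part (M.init e)))
    (hp : ∀ e, ContinuousOn (M.p e) (M.part (M.init e))) {f : K → ℝ} (hf : Continuous f) :
    Continuous (M.U f) := by
  refine continuous_finsetSum _ fun e _ => ?_
  refine M.continuous_of_continuousOn_part hopen (M.init e)
    ((hp e).mul (hf.comp_continuousOn (hw e))) fun y hy => ?_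
  simp [M.p_eq_zero e y hy]

end Feller

/-! ### Uniform convergence of Cesàro means from tightness and uniqueness. -/

section UniqueErgodicity

variable {K V E : Type*} [MetricSpace K] [MeasurableSpace K] [BorelSpace K] [Fintype V] [Fintype E]

/-- Cesàro means converge uniformly on sets of starting points for which the averaged laws are
tight. -/
theorem exists_abs_cesaro_sub_le (M : MarkovSystem K V E)
    (hopen : ∀ e, IsOpen (M.part (M.init e)))
    (hw : ∀ e, ContinuousOn (M.w e) (M.part (M.init e)))
    (hp : ∀ e, ContinuousOn (M.p e) (M.part (M.init e)))
    {μ : Measure K} (huniq : ∀ ν : Measure K, IsProbabilityMeasure ν → M.IsInvariant ν → ν = μ)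
    {S : Set K} (htight : ∀ y : ℕ → K, (∀ m, y m ∈ S) →
      IsTightMeasureSet (Set.range fun m => M.cesaroLaw m (y m)))
    (f : BoundedContinuousFunction K ℝ) {ε : ℝ} (hε : 0 < ε) :
    ∃ m, ∀ y ∈ S, |M.cesaro m f y - ∫ z, f z ∂μ| ≤ ε := by
  by_contra! hcon
  choose y hyS hy using hcon
  let ν : ℕ → ProbabilityMeasure K := fun m => ⟨M.cesaroLaw m (y m), inferInstance⟩
  have hcpt : IsCompact (closure (Set.range ν)) := by
    refine isCompact_closure_of_isTightMeasureSet ?_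
    convert htight y hyS using 1
    ext ρ
    constructor
    · rintro ⟨_, ⟨m, rfl⟩, rfl⟩
      exact ⟨m, rfl⟩
    · rintro ⟨m, rfl⟩
      exact ⟨ν m, ⟨m, rfl⟩, rfl⟩
  -- By Prokhorov's theorem the counterexample laws have a weak limit along a free ultrafilter; no
  -- subsequence is needed.
  obtain ⟨ρ, -, hρ⟩ := hcpt.ultrafilter_le_nhds ((hyperfilter ℕ).map ν)
    (by
      rw [le_principal_iff]
      exact mem_map.2 (Eventually.of_forall fun m => subset_closure (Set.mem_range_self m)))
  have hlim : Tendsto ν (hyperfilter ℕ : Filter ℕ) (𝓝 ρ) := hρ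
  rw [ProbabilityMeasure.tendsto_iff_forall_integral_tendsto] at hlim
  have hlim' (g : BoundedContinuousFunction K ℝ) :
      Tendsto (fun m => M.cesaro m g (y m)) (hyperfilter ℕ : Filter ℕ)
        (𝓝 (∫ z, g z ∂(ρ : Measure K))) :=
    (hlim g).congr fun m => M.integral_cesaroLaw g m (y m)
  have hinv : M.IsInvariant (ρ : Measure K) := by
    intro g
    have hg (z : K) : |g z| ≤ ‖g‖ := g.norm_coe_le_norm z
    let Ug : BoundedContinuousFunction K ℝ := BoundedContinuousFunction.ofNormedAddCommGroup
      (M.U g) (M.continuous_U hopen hw hp g.continuous) ‖g‖ (M.abs_iterate_U_le hg 1)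
    have hdiff : Tendsto (fun m => M.cesaro m (M.U g) (y m) - M.cesaro m g (y m))
        (hyperfilter ℕ : Filter ℕ) (𝓝 0) := by
      refine Tendsto.mono_left ?_ Nat.hyperfilter_le_atTop
      refine squeeze_zero_norm (fun m => M.abs_cesaro_U_sub_le hg m (y m)) ?_
      exact (tendsto_add_atTop_iff_nat 1).2
        (tendsto_const_div_atTop_nhds_zero_nat (2 * ‖g‖)) |>.congr fun m => by push_cast; rfl
    exact sub_eq_zero.1 (tendsto_nhds_unique ((hlim' Ug).sub (hlim' g)) hdiff)
  have hρμ : (ρ : Measure K) = μ := huniq ρ inferInstance hinv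
  have hf := hlim' f
  rw [hρμ] at hf
  obtain ⟨m, hm⟩ := ((Metric.tendsto_nhds.1 hf) ε hε).exists
  exact absurd hm (not_lt.2 (hy m).le)

end UniqueErgodicity

end MarkovSystem

/-- In a complete metric space, a set of measures which is concentrated, up to small mass, on
thickenings of finite sets is tight. -/
theorem isTightMeasureSet_of_finite_thickening {K : Type*} [MetricSpace K] [CompleteSpace K]
    [MeasurableSpace K] {S : Set (Measure K)}
    (h : ∀ ε : ENNReal, 0 < ε → ∀ δ : ℝ, 0 < δ → ∃ F : Set K, F.Finite ∧
      ∀ ν ∈ S, ν (Metric.thickening δ F)ᶜ ≤ ε) : IsTightMeasureSet S := by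
  rw [isTightMeasureSet_iff_exists_isCompact_measure_compl_le]
  intro ε hε
  obtain ⟨ε', hε'0, hε'⟩ := ENNReal.exists_pos_sum_of_countable' hε.ne' ℕ
  choose F hF hFε using fun l : ℕ => h (ε' l) (hε'0 l) (1 / ((l : ℝ) + 1)) (by positivity)
  refine ⟨⋂ l : ℕ, Metric.cthickening (1 / ((l : ℝ) + 1)) (F l), ?_, fun ν hν => ?_⟩
  · refine isCompact_iff_totallyBounded_isComplete.2 ⟨?_, (isClosed_iInter fun _ =>
      Metric.isClosed_cthickening).isComplete⟩
    rw [Metric.totallyBounded_iff]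
    intro δ hδ
    obtain ⟨l, hl⟩ := exists_nat_one_div_lt hδ
    refine ⟨F l, hF l, ?_⟩
    rw [← Metric.thickening_eq_biUnion_ball]
    exact (Set.iInter_subset _ l).trans (Metric.cthickening_subset_thickening' hδ hl _)
  · rw [Set.compl_iInter]
    calc ν (⋃ l : ℕ, (Metric.cthickening (1 / ((l : ℝ) + 1)) (F l))ᶜ)
        ≤ ∑' l : ℕ, ν (Metric.cthickening (1 / ((l : ℝ) + 1)) (F l))ᶜ := measure_iUnion_le _
      _ ≤ ∑' l, ε' l := ENNReal.tsum_le_tsum fun l => (measure_mono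
          (Set.compl_subset_compl.2 (Metric.thickening_subset_cthickening _ _))).trans (hFε l ν hν)
      _ ≤ ε := hε'.le

namespace MarkovSystem

/-! ### Contractive systems: tightness and rare excursions. -/

section Lyapunov

variable {K V E : Type*} [MeasurableSpace K] [Fintype V] [Fintype E]

/-- The vertex whose vertex set contains `y`. -/
noncomputable def vertex (M : MarkovSystem K V E) (y : K) : V :=
  (Set.mem_iUnion.1 (M.iUnion_part.symm ▸ Set.mem_univ y)).choose

theorem mem_part_vertex (M : MarkovSystem K V E) (y : K) : y ∈ M.part (M.vertex y) :=
  (Set.mem_iUnion.1 (M.iUnion_part.symm ▸ Set.mem_univ y)).choose_spec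

theorem vertex_eq (M : MarkovSystem K V E) {y : K} {i : V} (hy : y ∈ M.part i) :
    M.vertex y = i := by
  by_contra h
  exact Set.disjoint_left.1 (M.pairwise_disjoint_part h) (M.mem_part_vertex y) hy

/-- A base point of a vertex set. -/
noncomputable def base (M : MarkovSystem K V E) (i : V) : K := (M.part_nonempty i).some

theorem base_mem (M : MarkovSystem K V E) (i : V) : M.base i ∈ M.part i :=
  (M.part_nonempty i).some_mem

theorem mem_part_init_of_p_ne_zero (M : MarkovSystem K V E) {e : E} {y : K} (h : M.p e y ≠ 0) :
    y ∈ M.part (M.init e) := by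
  by_contra hy
  exact h (M.p_eq_zero e y hy)

theorem p_le_one (M : MarkovSystem K V E) (e : E) (y : K) : M.p e y ≤ 1 := by
  rw [← M.sum_p y]
  exact Finset.single_le_sum (fun e _ => M.p_nonneg e y) (Finset.mem_univ e)

/-- The points reached from `b` in `l` steps. -/
def reach (M : MarkovSystem K V E) : ℕ → K → Set K
  | 0, b => {b}
  | l + 1, b => ⋃ e, M.reach l (M.w e b)

theorem finite_reach (M : MarkovSystem K V E) (l : ℕ) (b : K) : (M.reach l b).Finite := by
  induction l generalizing b with
  | zero => exact Set.finite_singleton b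
  | succ l ih => exact Set.finite_iUnion fun e => ih _

variable {K : Type*} [MetricSpace K] [MeasurableSpace K]

/-- The distance to the base point of the vertex set containing `y`. -/
noncomputable def baseDist (M : MarkovSystem K V E) (y : K) : ℝ := dist y (M.base (M.vertex y))

theorem baseDist_nonneg (M : MarkovSystem K V E) (y : K) : 0 ≤ M.baseDist y := dist_nonneg

/-- The contractivity inequality with constant `a`. -/
def ContractsBy (M : MarkovSystem K V E) (a : ℝ) : Prop :=
  ∀ i, ∀ x ∈ M.part i, ∀ y ∈ M.part i,
    ∑ e, M.p e x * dist (M.w e x) (M.w e y) ≤ a * dist x y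

theorem IsContractive.exists_contractsBy {M : MarkovSystem K V E} (h : M.IsContractive) :
    ∃ a : ℝ, 0 < a ∧ a < 1 ∧ M.ContractsBy a := by
  obtain ⟨a, h0, h1, ha⟩ := h
  refine ⟨a, h0, h1, fun i => ?_⟩
  obtain ⟨e, rfl⟩ := M.exists_init_eq i
  exact ha e

/-- Drift condition: `w e y` is compared with the image of the base point of `y`, and the distances
from such images to base points are finitely many constants. -/
theorem ContractsBy.exists_U_baseDist_le {M : MarkovSystem K V E} {a : ℝ} (h : M.ContractsBy a) :
    ∃ C : ℝ, 0 ≤ C ∧ ∀ y, M.U M.baseDist y ≤ a * M.baseDist y + C := by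
  refine ⟨∑ e, ∑ i, dist (M.w e (M.base i)) (M.base (M.term e)), by positivity, fun y => ?_⟩
  have hstep (e : E) : M.p e y * M.baseDist (M.w e y) ≤
      M.p e y * dist (M.w e y) (M.w e (M.base (M.vertex y))) +
        ∑ i, dist (M.w e (M.base i)) (M.base (M.term e)) := by
    by_cases hpe : M.p e y = 0
    · simp only [hpe, zero_mul, zero_add]
      positivity
    have hy := M.mem_part_init_of_p_ne_zero hpe
    rw [baseDist, M.vertex_eq (M.mapsTo_w e hy)]
    set b := M.base (M.vertex y)
    calc M.p e y * dist (M.w e y) (M.base (M.term e))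
        ≤ M.p e y * (dist (M.w e y) (M.w e b) + dist (M.w e b) (M.base (M.term e))) :=
          mul_le_mul_of_nonneg_left (dist_triangle _ _ _) (M.p_nonneg e y)
      _ ≤ M.p e y * dist (M.w e y) (M.w e b) + dist (M.w e b) (M.base (M.term e)) := by
          rw [mul_add]
          gcongr
          exact mul_le_of_le_one_left dist_nonneg (M.p_le_one e y)
      _ ≤ _ := by
          gcongr
          exact Finset.single_le_sum
            (f := fun i => dist (M.w e (M.base i)) (M.base (M.term e)))
            (fun i _ => dist_nonneg) (Finset.mem_univ (M.vertex y))
  calc M.U M.baseDist y ≤ ∑ e, (M.p e y * dist (M.w e y) (M.w e (M.base (M.vertex y))) +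
        ∑ i, dist (M.w e (M.base i)) (M.base (M.term e))) := Finset.sum_le_sum fun e _ => hstep e
    _ ≤ _ := by
      rw [Finset.sum_add_distrib]
      gcongr
      exact h _ y (M.mem_part_vertex y) _ (M.base_mem _)

theorem iterate_U_baseDist_le (M : MarkovSystem K V E) {a C : ℝ} (ha0 : 0 < a) (ha1 : a < 1)
    (hC : 0 ≤ C) (hU : ∀ y, M.U M.baseDist y ≤ a * M.baseDist y + C) (j : ℕ) (y : K) :
    M.U^[j] M.baseDist y ≤ M.baseDist y + C / (1 - a) := by
  have h1a : 0 < 1 - a := by linarith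
  induction j with
  | zero => simpa using div_nonneg hC h1a.le
  | succ j ih =>
    have h1 := M.iterate_U_mono j (show M.U M.baseDist ≤ fun y => a * M.baseDist y + C from hU) y
    rw [iterate_U_affine] at h1
    rw [Function.iterate_succ_apply]
    have h2 : C / (1 - a) = a * (C / (1 - a)) + C := by field_simp; ring
    calc _ ≤ a * M.U^[j] M.baseDist y + C := h1
      _ ≤ a * (M.baseDist y + C / (1 - a)) + C := by gcongr
      _ = a * M.baseDist y + C / (1 - a) := by linarith
      _ ≤ M.baseDist y + C / (1 - a) := by
        gcongr
        exact mul_le_of_le_one_left (M.baseDist_nonneg y) ha1.le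

/-- Drive `y` and `b` by the same edges, chosen with the probabilities at `y`: they stay in common
vertex sets, their mean distance shrinks by `a` per step, and `b` ends in `F`. -/
theorem ContractsBy.iterate_U_infDist_le {M : MarkovSystem K V E} {a : ℝ} (h : M.ContractsBy a)
    (ha0 : 0 < a) {F : Set K} (l : ℕ) {i : V} {y b : K} (hy : y ∈ M.part i) (hb : b ∈ M.part i)
    (hF : M.reach l b ⊆ F) : M.U^[l] (fun z => Metric.infDist z F) y ≤ a ^ l * dist y b := by
  induction l generalizing i y b with
  | zero => simpa using Metric.infDist_le_dist_of_mem (hF rfl)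
  | succ l ih =>
    rw [Function.iterate_succ_apply', U]
    calc ∑ e, M.p e y * M.U^[l] (fun z => Metric.infDist z F) (M.w e y)
        ≤ ∑ e, M.p e y * (a ^ l * dist (M.w e y) (M.w e b)) := by
          refine Finset.sum_le_sum fun e _ => ?_
          by_cases hpe : M.p e y = 0
          · simp [hpe]
          have hye := M.mem_part_init_of_p_ne_zero hpe
          have hbe : b ∈ M.part (M.init e) := by
            rwa [← M.vertex_eq hye, M.vertex_eq hy]
          exact mul_le_mul_of_nonneg_left (ih (M.mapsTo_w e hye) (M.mapsTo_w e hbe)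
            ((Set.subset_iUnion (fun e => M.reach l (M.w e b)) e).trans hF)) (M.p_nonneg e y)
      _ = a ^ l * ∑ e, M.p e y * dist (M.w e y) (M.w e b) := by
          rw [Finset.mul_sum]
          exact Finset.sum_congr rfl fun e _ => by ring
      _ ≤ a ^ l * (a * dist y b) := by
          gcongr
          exact h i y hy b hb
      _ = a ^ (l + 1) * dist y b := by ring

theorem measure_thickening_compl_le [BorelSpace K] (M : MarkovSystem K V E) {F : Set K}
    (hF : F.Nonempty) {δ : ℝ} (hδ : 0 < δ) (m : ℕ) (y : K) :
    M.cesaroLaw m y (Metric.thickening δ F)ᶜ ≤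
      ENNReal.ofReal (M.cesaro m (fun z => Metric.infDist z F) y / δ) := by
  have hmeas : MeasurableSet (Metric.thickening δ F)ᶜ :=
    Metric.isOpen_thickening.measurableSet.compl
  have hsub (z : K) : (Metric.thickening δ F)ᶜ.indicator 1 z ≤ δ⁻¹ * Metric.infDist z F + 0 := by
    rw [add_zero]
    by_cases hz : z ∈ Metric.thickening δ F
    · simp only [Set.mem_compl_iff, hz, not_true, not_false_eq_true, Set.indicator_of_notMem]
      exact mul_nonneg (inv_pos.2 hδ).le Metric.infDist_nonneg
    · have : δ ≤ Metric.infDist z F := by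
        rw [Metric.mem_thickening_iff_infDist_lt hF] at hz
        exact not_lt.1 hz
      rw [Set.indicator_of_mem hz, inv_mul_eq_div, Pi.one_apply, one_le_div hδ]
      exact this
  rw [← ofReal_measureReal, ← integral_indicator_one hmeas, integral_cesaroLaw]
  refine ENNReal.ofReal_le_ofReal ?_
  rw [cesaro, cesaro, div_right_comm, Finset.sum_div _ _ δ]
  gcongr with j
  have := M.iterate_U_mono (m + 1 + j) hsub y
  rw [iterate_U_affine] at this
  rwa [← inv_mul_eq_div, ← add_zero (δ⁻¹ * _)]

theorem ContractsBy.isTightMeasureSet_cesaroLaw [BorelSpace K] [CompleteSpace K]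
    {M : MarkovSystem K V E} {a : ℝ} (h : M.ContractsBy a) (ha0 : 0 < a) (ha1 : a < 1) {R : ℝ}
    {y : ℕ → K} (hy : ∀ m, M.baseDist (y m) ≤ R) :
    IsTightMeasureSet (Set.range fun m => M.cesaroLaw m (y m)) := by
  obtain ⟨C, hC, hU⟩ := h.exists_U_baseDist_le
  have h1a : 0 < 1 - a := by linarith
  set D : ℝ := R + C / (1 - a) with hD
  have hD0 : 0 ≤ D :=
    add_nonneg ((M.baseDist_nonneg _).trans (hy 0)) (div_nonneg hC h1a.le)
  refine isTightMeasureSet_of_finite_thickening fun ε hε δ hδ => ?_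
  obtain ⟨r, hr0, hr⟩ : ∃ r : ℝ, 0 < r ∧ ENNReal.ofReal r ≤ ε := by
    rcases eq_or_ne ε ⊤ with rfl | hε'
    · exact ⟨1, one_pos, le_top⟩
    · exact ⟨ε.toReal, ENNReal.toReal_pos hε.ne' hε', (ENNReal.ofReal_toReal hε').le⟩
  obtain ⟨l, hl⟩ := exists_pow_lt_of_lt_one (show 0 < r * δ / (D + 1) by positivity) ha1
  have hl' : a ^ l * D ≤ r * δ := by
    rw [lt_div_iff₀ (by positivity)] at hl
    nlinarith [pow_pos ha0 l]
  -- When `l ≤ m + 1 + j`, the last `l` steps bring the chain near points reached from base points.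
  -- Otherwise `m, j < l`, because the Cesàro window starts at `m + 1`; these finitely many laws are
  -- covered by the points reached from `y m`. The point `y 0` makes `F` visibly nonempty.
  let F : Set K := (⋃ i, M.reach l (M.base i)) ∪
    (⋃ m ∈ Finset.range l, ⋃ j ∈ Finset.range l, M.reach (m + 1 + j) (y m)) ∪ {y 0}
  have hFfin : F.Finite := by
    refine ((Set.finite_iUnion fun i => M.finite_reach _ _).union ?_).union (Set.finite_singleton _)
    exact (Finset.range l).finite_toSet.biUnion fun m _ =>
      (Finset.range l).finite_toSet.biUnion fun j _ => M.finite_reach _ _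
  have hFne : F.Nonempty := ⟨y 0, Or.inr rfl⟩
  refine ⟨F, hFfin, ?_⟩
  rintro _ ⟨m, rfl⟩
  refine (M.measure_thickening_compl_le hFne hδ m (y m)).trans
    ((ENNReal.ofReal_le_ofReal ?_).trans hr)
  rw [div_le_iff₀ hδ, cesaro, div_le_iff₀ (by positivity)]
  have hj (j : ℕ) (hj : j < m + 1) :
      M.U^[m + 1 + j] (fun z => Metric.infDist z F) (y m) ≤ r * δ := by
    by_cases hml : l ≤ m + 1 + j
    · have h1 : M.U^[l] (fun z => Metric.infDist z F) ≤ fun z => a ^ l * M.baseDist z + 0 := by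
        intro z
        change _ ≤ a ^ l * M.baseDist z + 0
        rw [add_zero]
        exact h.iterate_U_infDist_le ha0 l (M.mem_part_vertex z) (M.base_mem _)
          fun b hb => Or.inl (Or.inl (Set.mem_iUnion.2 ⟨_, hb⟩))
      have h2 := M.iterate_U_mono (m + 1 + j - l) h1 (y m)
      rw [← Function.iterate_add_apply, Nat.sub_add_cancel hml, iterate_U_affine] at h2
      calc _ ≤ a ^ l * M.U^[m + 1 + j - l] M.baseDist (y m) := h2.trans_eq (add_zero _)
        _ ≤ a ^ l * D := by
          gcongr
          exact (M.iterate_U_baseDist_le ha0 ha1 hC hU _ _).trans (add_le_add_left (hy m) _)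
        _ ≤ r * δ := hl'
    · have h1 := h.iterate_U_infDist_le ha0 (F := F) (m + 1 + j) (M.mem_part_vertex (y m))
        (M.mem_part_vertex (y m)) fun b hb => Or.inl (Or.inr (Set.mem_biUnion
          (Finset.mem_coe.2 (Finset.mem_range.2 (show m < l by omega))) (Set.mem_biUnion
          (Finset.mem_coe.2 (Finset.mem_range.2 (show j < l by omega))) hb)))
      rw [dist_self, mul_zero] at h1
      exact h1.trans (by positivity)
  calc _ ≤ ∑ _j ∈ Finset.range (m + 1), r * δ :=
        Finset.sum_le_sum fun j hj' => hj j (Finset.mem_range.1 hj')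
    _ = r * δ * (m + 1) := by simp [mul_comm]

/-- Paths of a contractive system stay in a ball most of the time. -/
theorem ContractsBy.exists_ae_eventually_sum_indicator_le [MeasurableSpace E]
    [DiscreteMeasurableSpace E] {M : MarkovSystem K V E} {a : ℝ} (h : M.ContractsBy a)
    (ha0 : 0 < a) (ha1 : a < 1) (x : K) {θ : ℝ} (hθ : 0 < θ) :
    ∃ R : ℝ, ∀ᵐ σ ∂(M.pathMeasure x), ∀ᶠ n : ℕ in atTop, ∑ k ∈ Finset.range n,
      {y | M.baseDist y ≤ R}ᶜ.indicator (fun _ => (1 : ℝ)) (M.orbit x σ k) ≤ θ * n := by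
  obtain ⟨C, hC, hU⟩ := h.exists_U_baseDist_le
  have h1a : 0 < 1 - a := by linarith
  set κ : ℝ := Real.log (2 / (1 + a)) with hκ
  have hκ0 : 0 < κ := Real.log_pos (by rw [lt_div_iff₀ (by linarith)]; linarith)
  -- In `C + 2`, the `C` pays for the drift constant, one unit for the growth rate in
  -- `ae_eventually_sum_le`, and one for the initial value `log (1 + ε W x)`.
  set ε : ℝ := min (1 / (C + 1)) (κ * θ / (C + 2)) with hε
  have hε0 : 0 < ε := lt_min (by positivity) (by positivity)
  have hεC : ε * C ≤ 1 := by
    have h1 : ε ≤ 1 / (C + 1) := min_le_left _ _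
    rw [le_div_iff₀ (by positivity)] at h1
    linarith
  have hεκ : ε * (C + 2) ≤ κ * θ := by
    have h1 : ε ≤ κ * θ / (C + 2) := min_le_right _ _
    rwa [le_div_iff₀ (by positivity)] at h1
  set R : ℝ := 3 / (1 - a) / ε with hR
  let W : K → ℝ := M.baseDist
  have hW (y : K) : 0 ≤ W y := M.baseDist_nonneg y
  have hnum (y : K) : 0 < 1 + ε * W y := by have := hW y; positivity
  have hden (y : K) : 0 < 1 + ε * C + a * (ε * W y) := by have := hW y; positivity
  -- The drift condition bounds the conditional mean of the next `1 + ε W` by `1 + ε C + a ε W`, so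
  -- the logarithm of their quotient is an admissible summand.
  have key (y : K) : ∑ e, M.p e y * Real.exp (Real.log (1 + ε * W (M.w e y)) -
      Real.log (1 + ε * C + a * (ε * W y))) ≤ 1 := by
    have h1 (e : E) : M.p e y * Real.exp (Real.log (1 + ε * W (M.w e y)) -
        Real.log (1 + ε * C + a * (ε * W y))) =
        M.p e y * (1 + ε * W (M.w e y)) / (1 + ε * C + a * (ε * W y)) := by
      rw [Real.exp_sub, Real.exp_log (hnum _), Real.exp_log (hden _), mul_div_assoc]
    rw [Finset.sum_congr rfl fun e _ => h1 e, ← Finset.sum_div, div_le_one (hden y)]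
    have h2 : ∑ e, M.p e y * (1 + ε * W (M.w e y)) = 1 + ε * M.U W y := by
      simp only [mul_add, mul_one, Finset.sum_add_distrib, M.sum_p, U, Finset.mul_sum]
      congr 1
      exact Finset.sum_congr rfl fun e _ => by ring
    rw [h2]
    nlinarith [hU y]
  -- Outside the ball, `ε W (1 - a) ≥ 3` and `ε C ≤ 1` make the quotient at least `2 / (1 + a)`;
  -- inside, the loss is at most `ε C`. Summing and telescoping bounds `κ` times the number of
  -- exits.
  have hχ (y : K) : κ * {y | M.baseDist y ≤ R}ᶜ.indicator (fun _ => (1 : ℝ)) y - ε * C ≤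
      Real.log (1 + ε * W y) - Real.log (1 + ε * C + a * (ε * W y)) := by
    by_cases hy : M.baseDist y ≤ R
    · rw [Set.indicator_of_notMem (by simpa using hy), mul_zero, zero_sub, neg_le_sub_iff_le_add]
      calc Real.log (1 + ε * C + a * (ε * W y)) ≤ Real.log ((1 + ε * W y) * (1 + ε * C)) := by
            refine Real.log_le_log (hden y) ?_
            have h1 : 0 ≤ ε * W y := mul_nonneg hε0.le (hW y)
            have h2 : 0 ≤ ε * C := mul_nonneg hε0.le hC
            nlinarith [mul_nonneg h1 h2]
        _ = Real.log (1 + ε * W y) + Real.log (1 + ε * C) :=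
            Real.log_mul (hnum y).ne' (by positivity)
        _ ≤ Real.log (1 + ε * W y) + ε * C := by
            gcongr
            linarith [Real.log_le_sub_one_of_pos (show 0 < 1 + ε * C by positivity)]
    · rw [Set.indicator_of_mem (by simpa using hy), mul_one]
      have h1 : κ ≤ Real.log (1 + ε * W y) - Real.log (1 + ε * C + a * (ε * W y)) := by
        rw [← Real.log_div (hnum y).ne' (hden y).ne']
        refine Real.log_le_log (by positivity) ?_
        rw [div_le_div_iff₀ (by linarith) (hden y)]
        have h2 : 3 ≤ ε * W y * (1 - a) := by
          have h3 : R ≤ W y := (not_le.1 hy).le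
          rw [hR, div_div, div_le_iff₀ (by positivity)] at h3
          linarith
        nlinarith
      have h2 : 0 ≤ ε * C := mul_nonneg hε0.le hC
      linarith
  refine ⟨R, ?_⟩
  filter_upwards [M.ae_eventually_sum_le (fun e y => Real.log (1 + ε * W (M.w e y)) -
      Real.log (1 + ε * C + a * (ε * W y))) key x hε0] with σ hσ
  have hconst : ∀ᶠ n : ℕ in atTop, Real.log (1 + ε * W x) ≤ ε * n :=
    (tendsto_natCast_atTop_atTop.const_mul_atTop hε0).eventually_ge_atTop _
  filter_upwards [hσ, hconst] with n h1 h2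
  have htel : ∑ k ∈ Finset.range n, (Real.log (1 + ε * W (M.w (σ k) (M.orbit x σ k))) -
        Real.log (1 + ε * C + a * (ε * W (M.orbit x σ k)))) =
      (Real.log (1 + ε * W (M.orbit x σ n)) - Real.log (1 + ε * W x)) +
      ∑ k ∈ Finset.range n, (Real.log (1 + ε * W (M.orbit x σ k)) -
        Real.log (1 + ε * C + a * (ε * W (M.orbit x σ k)))) := by
    have := Finset.sum_range_sub (fun k => Real.log (1 + ε * W (M.orbit x σ k))) n
    rw [show M.orbit x σ 0 = x from rfl] at this
    rw [← this, ← Finset.sum_add_distrib]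
    refine Finset.sum_congr rfl fun k _ => ?_
    simp only [orbit]
    ring
  have hsum := Finset.sum_le_sum fun k (_ : k ∈ Finset.range n) => hχ (M.orbit x σ k)
  rw [Finset.sum_sub_distrib, ← Finset.mul_sum, Finset.sum_const, Finset.card_range,
    nsmul_eq_mul] at hsum
  have hlast : 0 ≤ Real.log (1 + ε * W (M.orbit x σ n)) :=
    Real.log_nonneg (by have := mul_nonneg hε0.le (hW (M.orbit x σ n)); linarith)
  refine le_of_mul_le_mul_left ?_ hκ0
  have hn : ε * (C + 2) * n ≤ κ * θ * n := mul_le_mul_of_nonneg_right hεκ n.cast_nonneg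
  linarith

end Lyapunov

/-! ### Logarithms of the cylinder probabilities. -/

section Entropy

variable {K V E : Type*} [MeasurableSpace K] [Fintype V] [Fintype E]

theorem abs_log_p_le (M : MarkovSystem K V E)
    (hpos : ∀ e, ∃ δ > 0, ∀ x ∈ M.part (M.init e), δ ≤ M.p e x) :
    ∃ B : ℝ, ∀ e y, |Real.log (M.p e y)| ≤ B := by
  choose δ hδ0 hδ using hpos
  refine ⟨∑ e, |Real.log (δ e)|, fun e y => ?_⟩
  by_cases hy : y ∈ M.part (M.init e)
  · have h1 : Real.log (M.p e y) ≤ 0 := Real.log_nonpos (M.p_nonneg e y) (M.p_le_one e y)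
    have h2 : Real.log (δ e) ≤ Real.log (M.p e y) := Real.log_le_log (hδ0 e) (hδ e y hy)
    rw [abs_of_nonpos h1]
    calc -Real.log (M.p e y) ≤ |Real.log (δ e)| := by
          linarith [neg_abs_le (Real.log (δ e))]
      _ ≤ _ := Finset.single_le_sum (f := fun e => |Real.log (δ e)|)
          (fun _ _ => abs_nonneg _) (Finset.mem_univ e)
  -- Off the vertex set the convention `Real.log 0 = 0` keeps the bound global.
  · rw [M.p_eq_zero e y hy, Real.log_zero, abs_zero]
    positivity

variable [MeasurableSpace E] [DiscreteMeasurableSpace E]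

theorem ae_log_pathMeasure_cylinderSet (M : MarkovSystem K V E) (x : K) :
    ∀ᵐ σ ∂(M.pathMeasure x), ∀ n, Real.log ((M.pathMeasure x).real (cylinderSet σ n)) =
      ∑ k ∈ Finset.range n, Real.log (M.p (σ k) (M.orbit x σ k)) := by
  filter_upwards [M.ae_p_orbit_ne_zero x] with σ hσ n
  rw [Measure.real, pathMeasure_cylinderSet, ENNReal.toReal_prod, Real.log_prod]
  · exact Finset.sum_congr rfl fun k _ => by rw [ENNReal.toReal_ofReal (M.p_nonneg _ _)]
  · intro k _
    rw [ENNReal.toReal_ofReal (M.p_nonneg _ _)]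
    exact hσ k

end Entropy

/-! ### Breiman's ergodic theorem and the conclusion. -/

section Breiman

variable {K V E : Type*} [MetricSpace K] [MeasurableSpace K] [BorelSpace K] [Fintype V] [Fintype E]
  [MeasurableSpace E] [DiscreteMeasurableSpace E]

/-- Breiman's ergodic theorem: averages of bounded continuous functions along paths from an
arbitrary starting point converge to the integral with respect to the unique invariant measure. -/
theorem ae_tendsto_average_integral (M : MarkovSystem K V E)
    (hopen : ∀ e, IsOpen (M.part (M.init e)))
    (hw : ∀ e, ContinuousOn (M.w e) (M.part (M.init e)))
    (hp : ∀ e, ContinuousOn (M.p e) (M.part (M.init e)))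
    (hK : CompactSpace K ∨ (CompleteSpace K ∧ M.IsContractive))
    {μ : Measure K} (huniq : ∀ ν : Measure K, IsProbabilityMeasure ν → M.IsInvariant ν → ν = μ)
    (f : BoundedContinuousFunction K ℝ) (x : K) :
    ∀ᵐ σ ∂(M.pathMeasure x), Tendsto (fun n : ℕ => (∑ k ∈ Finset.range n,
      f (M.orbit x σ k)) / n) atTop (𝓝 (∫ z, f z ∂μ)) := by
  refine M.ae_tendsto_average (f := f) f.norm_coe_le_norm x _ fun η hη => ?_
  rcases hK with hK | ⟨hK, hcontr⟩
  · refine ⟨Set.univ, fun ε hε => M.exists_abs_cesaro_sub_le hopen hw hp huniq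
      (fun _ _ => .of_compactSpace) f hε, Eventually.of_forall fun σ => Eventually.of_forall
      fun n => ?_⟩
    simpa using mul_nonneg hη.le n.cast_nonneg
  · obtain ⟨a, ha0, ha1, ha⟩ := hcontr.exists_contractsBy
    obtain ⟨R, hR⟩ := ha.exists_ae_eventually_sum_indicator_le ha0 ha1 x hη
    exact ⟨_, fun ε hε => M.exists_abs_cesaro_sub_le hopen hw hp huniq
      (fun y hy => ha.isTightMeasureSet_cesaroLaw ha0 ha1 hy) f hε, hR⟩

end Breiman

end MarkovSystem

theorem corollary3 {K V E : Type*} [MetricSpace K] [MeasurableSpace K] [BorelSpace K]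
    [Fintype V] [Fintype E] [MeasurableSpace E] [DiscreteMeasurableSpace E]
    (M : MarkovSystem K V E)
    (hopen : ∀ e, IsOpen (M.part (M.init e)))
    (hw : ∀ e, ContinuousOn (M.w e) (M.part (M.init e)))
    (hp : ∀ e, ContinuousOn (M.p e) (M.part (M.init e)))
    (hpos : ∀ e, ∃ δ > 0, ∀ x ∈ M.part (M.init e), δ ≤ M.p e x)
    (hK : CompactSpace K ∨
      (CompleteSpace K ∧ TopologicalSpace.SeparableSpace K ∧ M.IsContractive))
    (μ : Measure K) [IsProbabilityMeasure μ] (hμ : M.IsInvariant μ)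
    (huniq : ∀ ν : Measure K, IsProbabilityMeasure ν → M.IsInvariant ν → ν = μ)
    (x : K) :
    ∀ᵐ σ ∂(M.pathMeasure x),
      Tendsto (fun n : ℕ => (1 / (n : ℝ)) * Real.log ((M.pathMeasure x).real (cylinderSet σ n)))
        atTop
        (𝓝 (∑ e, ∫ y in M.part (M.init e), M.p e y * Real.log (M.p e y) ∂μ)) := by
  obtain ⟨B, hB⟩ := M.abs_log_p_le hpos
  -- `t log t` is continuous at `0` too, so the extension by zero does no harm.
  have hcont (e : E) : Continuous fun y => M.p e y * Real.log (M.p e y) :=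
    Real.continuous_mul_log.comp (M.continuous_p hopen hp e)
  let g : BoundedContinuousFunction K ℝ := BoundedContinuousFunction.ofNormedAddCommGroup
    (fun y => ∑ e, M.p e y * Real.log (M.p e y)) (continuous_finsetSum _ fun e _ => hcont e) B
    (M.abs_sum_p_mul_le hB)
  have hint : ∑ e, ∫ y in M.part (M.init e), M.p e y * Real.log (M.p e y) ∂μ = ∫ y, g y ∂μ := by
    change _ = ∫ y, ∑ e, M.p e y * Real.log (M.p e y) ∂μ
    rw [integral_finsetSum]
    · refine Finset.sum_congr rfl fun e _ => setIntegral_eq_integral_of_forall_compl_eq_zero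
        fun y hy => ?_
      rw [M.p_eq_zero e y hy, zero_mul]
    · intro e _
      refine Integrable.of_bound
        ((M.measurable_p e).mul (M.measurable_p e).log).aestronglyMeasurable B
        (Eventually.of_forall fun y => ?_)
      rw [norm_mul, Real.norm_eq_abs, Real.norm_eq_abs, abs_of_nonneg (M.p_nonneg e y)]
      exact (mul_le_of_le_one_left (abs_nonneg _) (M.p_le_one e y)).trans (hB e y)
  rw [hint]
  -- The conditional mean of `log p` is `g`, so the martingale part and the average of `g` add up to
  -- the average of `log p` along the path.
  filter_upwards [M.ae_log_pathMeasure_cylinderSet x,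
    M.ae_tendsto_average_integral hopen hw hp (hK.imp_right fun h => ⟨h.1, h.2.2⟩) huniq g x,
    M.ae_tendsto_sum_sub_mean (fun e y => Real.log (M.p e y)) hB x] with σ h1 h2 h3
  have := h3.add h2
  rw [zero_add] at this
  refine this.congr fun n => ?_
  rw [h1 n, ← add_div, ← Finset.sum_add_distrib, one_div, inv_mul_eq_div]
  congr 1
  refine Finset.sum_congr rfl fun k _ => ?_
  simp [g]
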